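/- Consider $n$ agents with positions $p_1,\dots,p_n\in\mathbb{R}^d$, $d\in\{2,3\}$, and write $p=(p_1,\dots,p_n)\in\mathbb{R}^{dn}$, $b_{ij}=\frac{p_j-p_i}{\|p_j-p_i\|}$. Let $\mathcal{A}$ be a finite set of triples of agents. Let $\mathcal{S}$ be a finite set of triples of agents if $d=2$, and of quadruples of agents if $d=3$. Each $(i,j,k)\in\mathcal{A}$ gives the unsigned angle constraint function $\cos\theta^i_{jk}(p)=b_{ij}^\top b_{ik}$. Each element of $\mathcal{S}$ gives a signed constraint function: $\bar S_{ijk}(p)=\det[\,b_{ij}\ \ b_{ik}\,]$ for $(i,j,k)\in\mathcal{S}$ if $d=2$ (signed angle), and $\bar V_{ijkl}(p)=b_{ij}^\top(b_{ik}\times b_{il})$ for $(i,j,k,l)\in\mathcal{S}$ if $d=3$ (signed volume). Let $\chi\subset\mathbb{R}^{dn}$ be the (open) set of all $p$ for which every bearing occurring in these functions is defined, i.e. the two agents involved do not coincide. Let $a(p)$ and $s(p)$ be the vectors of unsigned angle and of signed constraint functions on $\chi$, with Jacobians $R_W(p)=\partial a/\partial p$ and $R_\pm(p)=\partial s/\partial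 p$. A configuration $p\in\chi$ is called IRAS (infinitesimally rigid with angle and signed constraints) if every $v=(v_1,\dots,v_n)\in\mathbb{R}^{dn}$ with $R_W(p)v=0$ and $R_\pm(p)v=0$ is a trivial motion, i.e. $v_i=\beta+\Omega p_i+c\,p_i$ for all $i$, with some $\beta\in\mathbb{R}^d$, some skew-symmetric $\Omega\in\mathbb{R}^{d\times d}$ and some $c\in\mathbb{R}$. Let $\hat p\in\chi$ be a desired IRAS configuration, let $k\neq 0$ be a constant, and consider on $\chi$ the gradient control law $$\dot p=-\overline{R}_A(p)^\top e(p),\qquad \overline{R}_A(p)=\begin{bmatrix}R_W(p)\\ k\,R_\pm(p)\end{bmatrix},\qquad e(p)=\begin{bmatrix}a(p)-a(\hat p)\\ k\,s(p)-k\,s(\hat p)\end{bmatrix}.$$ Let $\psi$ be the set of configurations similar to $\hat p$, i.e. of all $(cQ\hat p_i+\beta)_{i=1,\dots,n}$ with $c>0$, $Q\in SO(d)$ and $\beta\in\mathbb{R}^d$. **Theorem.** For every $p^*\in\psi$ there are a neighbourhood $\mathcal{B}_{p^*}$ of $p^*$ in $\mathbb{R}^{dn}$ and constants $\gamma>0$,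 $C$ such that for every $p_0\in\mathcal{B}_{p^*}$ a trajectory $p:[0,\infty)\to\chi$ of the control law with $p(0)=p_0$ exists, and every such trajectory converges exponentially fast to a fixed element of $\psi$: there is $p^\dagger\in\psi$ with $$\|p(t)-p^\dagger\|\le C e^{-\gamma t}\qquad\text{for all } t\ge 0.$$ -/

import Mathlib

open scoped Topology

namespace Formation

noncomputable section

/-- Realizations `p = (p_1, …, p_n)` of `n` agents in `ℝ^d`, as vectors of `ℝ^{dn}` with the
Euclidean norm; the coordinate `(i, a)` is the `a`-th coordinate of the position of agent `i`. -/
abbrev Config (n d : ℕ) := EuclideanSpace ℝ (Fin n × Fin d)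

variable {n d : ℕ}

/-- The position `p_i` of agent `i`. -/
def pos (p : Config n d) (i : Fin n) : EuclideanSpace ℝ (Fin d) :=
  WithLp.toLp 2 fun a => p (i, a)

/-- The bearing `(p_j - p_i) / ‖p_j - p_i‖` of agent `j` as seen from agent `i`. -/
def bearing (p : Config n d) (i j : Fin n) : EuclideanSpace ℝ (Fin d) :=
  ‖pos p j - pos p i‖⁻¹ • (pos p j - pos p i)

/-- For `(i, j, k)`: the cosine of the unsigned angle `θ^i_{jk} ∈ [0, π]` subtended at agent `i`
by agents `j` and `k`. -/
def cosAngle (c : Fin n × Fin n × Fin n) (p : Config n d) : ℝ :=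
  Real.cos (EuclideanGeometry.angle (pos p c.2.1) (pos p c.1) (pos p c.2.2))

/-- For `(i, j, k)`, in the plane: the signed angle function, i.e. the determinant of the matrix
whose columns are the bearings of `j` and `k` from `i`. -/
def signedAngle (c : Fin n × Fin n × Fin n) (p : Config n 2) : ℝ :=
  Matrix.det !![bearing p c.1 c.2.1 0, bearing p c.1 c.2.2 0;
                bearing p c.1 c.2.1 1, bearing p c.1 c.2.2 1]

/-- For `(i, j, k, l)`, in space: the normalized signed volume, i.e. the triple product of the
bearings of `j`, `k` and `l` from `i`. -/
def signedVolume (c : Fin n × Fin n × Fin n × Fin n) (p : Config n 3) : ℝ :=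
  dotProduct (bearing p c.1 c.2.1).ofLp
    (crossProduct (bearing p c.1 c.2.2.1).ofLp (bearing p c.1 c.2.2.2).ofLp)

/-- The vector of unsigned angle constraint functions `cos θ^i_{jk}`, `(i, j, k) ∈ A`. -/
def angleFn (A : Finset (Fin n × Fin n × Fin n)) (p : Config n d) : A → ℝ :=
  fun c => cosAngle c.1 p

/-- The vector of signed angle constraint functions, `(i, j, k) ∈ S`. -/
def signedAngleFn (S : Finset (Fin n × Fin n × Fin n)) (p : Config n 2) : S → ℝ :=
  fun c => signedAngle c.1 p

/-- The vector of signed volume constraint functions, `(i, j, k, l) ∈ S`. -/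
def signedVolumeFn (S : Finset (Fin n × Fin n × Fin n × Fin n)) (p : Config n 3) : S → ℝ :=
  fun c => signedVolume c.1 p

/-- The planar configurations at which all bearings that enter the angle constraints `A` and the
signed angle constraints `S` are defined. -/
def domain2 (A S : Finset (Fin n × Fin n × Fin n)) : Set (Config n 2) :=
  {p | (∀ c ∈ A, pos p c.2.1 ≠ pos p c.1 ∧ pos p c.2.2 ≠ pos p c.1) ∧
       (∀ c ∈ S, pos p c.2.1 ≠ pos p c.1 ∧ pos p c.2.2 ≠ pos p c.1)}

/-- The spatial configurations at which all bearings that enter the angle constraints `A` and the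
signed volume constraints `S` are defined. -/
def domain3 (A : Finset (Fin n × Fin n × Fin n)) (S : Finset (Fin n × Fin n × Fin n × Fin n)) :
    Set (Config n 3) :=
  {p | (∀ c ∈ A, pos p c.2.1 ≠ pos p c.1 ∧ pos p c.2.2 ≠ pos p c.1) ∧
       (∀ c ∈ S, pos p c.2.1 ≠ pos p c.1 ∧ pos p c.2.2.1 ≠ pos p c.1 ∧
         pos p c.2.2.2 ≠ pos p c.1)}

/-- The Jacobian matrix `∂F/∂p` of a vector of constraint functions. -/
def jacobian {ι : Type} (F : Config n d → ι → ℝ) (p : Config n d) :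
    Matrix ι (Fin n × Fin d) ℝ :=
  Matrix.of fun r c => fderiv ℝ (fun q => F q r) p (EuclideanSpace.single c 1)

section General

variable {ι κ : Type}

/-- The rigidity matrix `R_A(p)`: the Jacobian of the angle constraint functions `a` stacked on
that of the signed constraint functions `s`. -/
def rigidityMatrix (a : Config n d → ι → ℝ) (s : Config n d → κ → ℝ) (p : Config n d) :
    Matrix (ι ⊕ κ) (Fin n × Fin d) ℝ :=
  Matrix.fromRows (jacobian a p) (jacobian s p)

/-- The weighted rigidity matrix, in which the rows of the signed constraints are multiplied by
the gain `k`. -/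
def weightedRigidityMatrix (k : ℝ) (a : Config n d → ι → ℝ) (s : Config n d → κ → ℝ)
    (p : Config n d) : Matrix (ι ⊕ κ) (Fin n × Fin d) ℝ :=
  Matrix.fromRows (jacobian a p) (k • jacobian s p)

/-- The error `e(p)`: the difference between the values at `p` and the desired values, which are
those of the desired formation `pd`, of the constraint functions `(a, k s)`. -/
def errorVec (k : ℝ) (a : Config n d → ι → ℝ) (s : Config n d → κ → ℝ) (pd p : Config n d) :
    ι ⊕ κ → ℝ :=
  Sum.elim (fun r => a p r - a pd r) (fun r => k * s p r - k * s pd r)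

/-- The control law `u(p) = -R̄_A(p)ᵀ e(p)`. -/
def controlLaw [Fintype ι] [Fintype κ] (k : ℝ) (a : Config n d → ι → ℝ)
    (s : Config n d → κ → ℝ) (pd p : Config n d) : Config n d :=
  WithLp.toLp 2
    (-((weightedRigidityMatrix k a s p).transpose.mulVec (errorVec k a s pd p)))

/-- Trivial motions of the framework `p`: sums of an infinitesimal translation, an infinitesimal
rotation and an infinitesimal scaling. -/
def IsTrivialMotion (p v : Config n d) : Prop :=
  ∃ (b : EuclideanSpace ℝ (Fin d)) (Ω : Matrix (Fin d) (Fin d) ℝ) (c : ℝ),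
    Ω.transpose = -Ω ∧
    ∀ i, pos v i = b + WithLp.toLp 2 (Ω.mulVec (pos p i).ofLp) + c • pos p i

/-- Infinitesimal rigidity with angle and signed constraints: all infinitesimal motions of the
framework, i.e. all `v` with `R_A(p) v = 0`, are trivial. -/
def IsIRAS (a : Config n d → ι → ℝ) (s : Config n d → κ → ℝ) (p : Config n d) : Prop :=
  ∀ v : Config n d, (rigidityMatrix a s p).mulVec v.ofLp = 0 → IsTrivialMotion p v

end General

/-- The set of configurations similar to `p`: the images of `p` under a rotation (no reflection),
a scaling by a positive factor and a translation of the whole formation. -/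
def similarityClass (p : Config n d) : Set (Config n d) :=
  {q | ∃ (c : ℝ) (Q : Matrix (Fin d) (Fin d) ℝ) (b : EuclideanSpace ℝ (Fin d)),
    0 < c ∧ Q ∈ Matrix.specialOrthogonalGroup (Fin d) ℝ ∧
    ∀ i, pos q i = c • WithLp.toLp 2 (Q.mulVec (pos p i).ofLp) + b}

/-- `p` is a trajectory on `[0, ∞)` of `ṗ = f(p)` inside the domain `χ` of the law `f`. -/
def IsTrajectory (χ : Set (Config n d)) (f : Config n d → Config n d) (p : ℝ → Config n d) :
    Prop :=
  ∀ t : ℝ, 0 ≤ t → p t ∈ χ ∧ HasDerivWithinAt p (f (p t)) (Set.Ici 0) t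

/-- Around every point of `ψ`, the flow of `ṗ = f(p)` on `χ` converges exponentially fast to points
of `ψ`: the trajectories that start in a neighbourhood exist for all positive times, and each of
them converges to a fixed point of `ψ`, with a rate and a constant that are uniform on the
neighbourhood. -/
def LocallyExpConverges (χ : Set (Config n d)) (f : Config n d → Config n d)
    (ψ : Set (Config n d)) : Prop :=
  ∀ pstar ∈ ψ, ∃ B ∈ 𝓝 pstar, ∃ γ > (0 : ℝ), ∃ C : ℝ,
    ∀ p₀ ∈ B,
      (∃ p : ℝ → Config n d, p 0 = p₀ ∧ IsTrajectory χ f p) ∧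
      ∀ p : ℝ → Config n d, p 0 = p₀ → IsTrajectory χ f p →
        ∃ pdag ∈ ψ, ∀ t : ℝ, 0 ≤ t → ‖p t - pdag‖ ≤ C * Real.exp (-γ * t)

end

end Formation

/-! Stack the constraints into `F = (a, k s)`. The control law is the negative gradient flow of the
energy `V = ½‖F - F(pd)‖²`, and `F` is invariant under orientation-preserving similarities, so `V`
vanishes on all of `ψ` and its zeros are not isolated. Convergence therefore rests on a
Polyak–Łojasiewicz inequality `c V ≤ ‖∇V‖²` rather than on a nondegenerate Hessian.

Let `T` be the space of trivial motions of `pd`. IRAS says that the kernel of `DF(pd)` lies in `T`,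
so `DF(pd)` is injective on `Tᗮ`. Similarities applied to the slice `pd + Tᗮ` fill a neighbourhood
of every point of `ψ` (`eventually_exists_similarity_slice`). On the slice the residual is `DF(pd)
s` to first order, and pairing the gradient with the transported displacement `s` gives the
inequality; it also shows that nearby zeros of `V` lie in `ψ` (`exists_energy_le_norm_gradient_sq`).

The inequality makes `V` decay exponentially along trajectories. Since `‖∇V‖² ≤ L V`, the speed
decays too, so the remaining length is exponentially small: trajectories stay near their start and
converge to a zero of `V` (`gradientFlow_locally_exp_converges`). -/

namespace Formation

/-! ### Gradient flows under a Polyak–Łojasiewicz inequality. -/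

section Flow

open Set Metric

/-- A bounded Lipschitz vector field has a solution for all times. -/
theorem exists_forall_hasDerivAt_of_lipschitzWith {E : Type*} [NormedAddCommGroup E]
    [NormedSpace ℝ E] [CompleteSpace E] {g : E → E} {K L : NNReal} (hK : LipschitzWith K g)
    (hL : ∀ x, ‖g x‖ ≤ L) (x₀ : E) :
    ∃ p : ℝ → E, p 0 = x₀ ∧ ∀ t, HasDerivAt p (g (p t)) t := by
  have hsol : ∀ m : ℕ, ∃ q : ℝ → E, q 0 = x₀ ∧
      ∀ t ∈ Icc (-(m : ℝ)) m, HasDerivWithinAt q (g (q t)) (Icc (-(m : ℝ)) m) t := by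
    intro m
    have hm : (0 : ℝ) ≤ m := m.cast_nonneg
    -- Speed at most `L` during time `m` stays within radius `L * m`; the hypotheses on `g` are
    -- global, so this radius is allowed.
    have hpl : IsPicardLindelof (fun _ : ℝ => g) (tmin := -(m : ℝ)) (tmax := m)
        ⟨0, by simp⟩ x₀ (L * m) 0 L K :=
      { lipschitzOnWith := fun _ _ => hK.lipschitzOnWith
        continuousOn := fun _ _ => continuousOn_const
        norm_le := fun _ _ x _ => hL x
        mul_max_le := by simp }
    exact hpl.exists_eq_forall_mem_Icc_hasDerivWithinAt₀
  choose q hq0 hq using hsol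
  have hder : ∀ m : ℕ, ∀ t ∈ Ioo (-(m : ℝ)) m, HasDerivAt (q m) (g (q m t)) t := fun m t ht =>
    (hq m t (Ioo_subset_Icc_self ht)).hasDerivAt (Icc_mem_nhds ht.1 ht.2)
  have huniq : ∀ m l : ℕ, m ≤ l → ∀ t : ℝ, |t| < m → q m t = q l t := by
    intro m l hml t ht
    have hml' : (m : ℝ) ≤ l := by exact_mod_cast hml
    have htm : (0 : ℝ) < m := (abs_nonneg t).trans_lt ht
    have := ODE_solution_unique_of_mem_Ioo (v := fun _ => g) (s := fun _ => univ) (K := K)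
      (a := -(m : ℝ)) (b := m) (t₀ := 0) (f := q m) (g := q l)
      (fun _ _ => hK.lipschitzOnWith) ⟨by linarith, htm⟩
      (fun s hs => ⟨hder m s hs, mem_univ _⟩)
      (fun s hs => ⟨hder l s ⟨by linarith [hs.1], by linarith [hs.2]⟩, mem_univ _⟩)
      ((hq0 m).trans (hq0 l).symm)
    exact this (abs_lt.1 ht)
  -- The index is the least integer strictly above `|t|`, which makes `t` an interior point of the
  -- interval.
  refine ⟨fun t => q (⌊|t|⌋₊ + 1) t, hq0 _, fun t => ?_⟩
  have key : ∀ s : ℝ, ∀ N : ℕ, |s| < N → q (⌊|s|⌋₊ + 1) s = q N s := by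
    intro s N hs
    refine huniq _ _ ?_ s (by exact_mod_cast Nat.lt_floor_add_one |s|)
    exact Nat.succ_le_of_lt ((Nat.floor_lt (abs_nonneg s)).2 hs)
  obtain ⟨N, hN⟩ := exists_nat_gt |t|
  beta_reduce
  rw [key t N hN]
  refine (hder N t (abs_lt.1 hN)).congr_of_eventuallyEq ?_
  filter_upwards [(continuous_abs.tendsto t).eventually (gt_mem_nhds hN)] with s hs
  exact key s N hs

/-- Along a curve with velocity `f`, an energy `V` with `V' f = -‖f‖²` and `c V ≤ ‖f‖²` decays
exponentially. -/
theorem energy_mul_exp_le {E : Type*} [NormedAddCommGroup E] [NormedSpace ℝ E]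
    {V : E → ℝ} {V' : E → E →L[ℝ] ℝ} {f : E → E} {s : Set E} {c : ℝ}
    (hV : ∀ x ∈ s, HasFDerivAt V (V' x) x) (hVf : ∀ x ∈ s, V' x (f x) = -‖f x‖ ^ 2)
    (hlow : ∀ x ∈ s, c * V x ≤ ‖f x‖ ^ 2) {p : ℝ → E} {T : ℝ} (hps : ∀ t ∈ Icc 0 T, p t ∈ s)
    (hp : ∀ t ∈ Icc 0 T, HasDerivWithinAt p (f (p t)) (Ici 0) t) :
    ∀ t ∈ Icc 0 T, V (p t) ≤ V (p 0) * Real.exp (-(c * t)) := by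
  -- The derivative of `V(p) e^{ct}` is `(c V - ‖f‖²) e^{ct} ≤ 0`.
  have hdecay : ∀ t ∈ Icc 0 T, V (p t) * Real.exp (c * t) ≤ V (p 0) := by
    refine image_le_of_deriv_right_le_deriv_boundary (B := fun _ => V (p 0)) (B' := fun _ => 0)
      (f := fun t => V (p t) * Real.exp (c * t))
      (f' := fun t => V' (p t) (f (p t)) * Real.exp (c * t) +
        V (p t) * (Real.exp (c * t) * c)) ?_ ?_ (by simp) continuousOn_const
      (fun t _ => hasDerivWithinAt_const _ _ _) ?_
    · refine ContinuousOn.mul (fun t ht => ?_) (by fun_prop)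
      exact (hV _ (hps t ht)).continuousAt.comp_continuousWithinAt
        ((hp t ht).continuousWithinAt.mono Icc_subset_Ici_self)
    · intro t ht
      refine HasDerivWithinAt.mul
        ((hV _ (hps t (Ico_subset_Icc_self ht))).comp_hasDerivWithinAt t
          ((hp t (Ico_subset_Icc_self ht)).mono (Ici_subset_Ici.2 ht.1))) ?_
      have : HasDerivAt (fun t : ℝ => Real.exp (c * t)) (Real.exp (c * t) * c) t := by
        simpa using ((hasDerivAt_id t).const_mul c).exp
      exact this.hasDerivWithinAt
    · intro t ht
      have h := hps t (Ico_subset_Icc_self ht)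
      rw [hVf _ h]
      have := hlow _ h
      nlinarith [Real.exp_pos (c * t)]
  intro t ht
  rw [Real.exp_neg, ← div_eq_mul_inv, le_div_iff₀ (Real.exp_pos _)]
  exact hdecay t ht

/-- A curve with velocity `f`, along which the energy `V` satisfies `V' f = -‖f‖²` and
`c V ≤ ‖f‖² ≤ L V`, has exponentially small tails. -/
theorem norm_sub_le_of_energy {E : Type*} [NormedAddCommGroup E] [NormedSpace ℝ E]
    {V : E → ℝ} {V' : E → E →L[ℝ] ℝ} {f : E → E} {s : Set E} {c L : ℝ} (hc : 0 < c)
    (hV : ∀ x ∈ s, HasFDerivAt V (V' x) x) (hVf : ∀ x ∈ s, V' x (f x) = -‖f x‖ ^ 2)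
    (hlow : ∀ x ∈ s, c * V x ≤ ‖f x‖ ^ 2) (hup : ∀ x ∈ s, ‖f x‖ ^ 2 ≤ L * V x) (hL : 0 ≤ L)
    {p : ℝ → E} {T : ℝ} (hps : ∀ t ∈ Icc 0 T, p t ∈ s)
    (hp : ∀ t ∈ Icc 0 T, HasDerivWithinAt p (f (p t)) (Ici 0) t) {t₁ t₂ : ℝ} (h₁ : 0 ≤ t₁)
    (h₁₂ : t₁ ≤ t₂) (h₂ : t₂ ≤ T) :
    ‖p t₂ - p t₁‖ ≤ 2 / c * √(L * V (p 0)) * (Real.exp (-(c / 2) * t₁) -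
      Real.exp (-(c / 2) * t₂)) := by
  have hpc : ContinuousOn p (Icc 0 T) := fun t ht =>
    ((hp t ht).continuousWithinAt).mono Icc_subset_Ici_self
  have hpr : ∀ t ∈ Ico 0 T, HasDerivWithinAt p (f (p t)) (Ici t) t := fun t ht =>
    (hp t (Ico_subset_Icc_self ht)).mono (Ici_subset_Ici.2 ht.1)
  have hspeed : ∀ t ∈ Icc 0 T, ‖f (p t)‖ ≤ √(L * V (p 0)) * Real.exp (-(c / 2) * t) := by
    intro t ht
    refine abs_le_of_sq_le_sq' ?_ (by positivity) |>.2
    have h2 : Real.exp (-(c / 2) * t) ^ 2 = Real.exp (-(c * t)) := by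
      rw [← Real.exp_nat_mul]; congr 1; push_cast; ring
    have h3 := energy_mul_exp_le hV hVf hlow hps hp t ht
    have h0 : p 0 ∈ s := hps 0 ⟨le_rfl, ht.1.trans ht.2⟩
    have h4 : 0 ≤ L * V (p 0) := (sq_nonneg _).trans (hup _ h0)
    rw [mul_pow, h2, Real.sq_sqrt h4]
    calc ‖f (p t)‖ ^ 2 ≤ L * V (p t) := hup _ (hps t ht)
      _ ≤ L * (V (p 0) * Real.exp (-(c * t))) := by gcongr
      _ = _ := by ring
  have hsub : Icc t₁ t₂ ⊆ Icc 0 T := Icc_subset_Icc h₁ h₂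
  -- The bound is the integral of the speed bound from `t₁`; the rate is halved because speed is
  -- controlled by the square root of the energy.
  refine image_norm_le_of_norm_deriv_right_le_deriv_boundary (a := t₁) (b := t₂)
    (f := fun t => p t - p t₁) (f' := fun t => f (p t))
    (B := fun t => 2 / c * √(L * V (p 0)) * (Real.exp (-(c / 2) * t₁) -
      Real.exp (-(c / 2) * t)))
    (B' := fun t => √(L * V (p 0)) * Real.exp (-(c / 2) * t)) ?_ ?_ (by simp) ?_ ?_
    (right_mem_Icc.2 h₁₂)
  · exact (hpc.mono hsub).sub continuousOn_const
  · intro t ht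
    exact (hpr t ⟨h₁.trans ht.1, ht.2.trans_le h₂⟩).sub_const _
  · intro t
    have : HasDerivAt (fun t : ℝ => Real.exp (-(c / 2) * t))
        (Real.exp (-(c / 2) * t) * -(c / 2)) t := by
      simpa using ((hasDerivAt_id t).const_mul (-(c / 2))).exp
    refine ((this.const_sub (Real.exp (-(c / 2) * t₁))).const_mul
      (2 / c * √(L * V (p 0)))).congr_deriv ?_
    field_simp
  · intro t ht
    exact hspeed t (hsub (Ico_subset_Icc_self ht))

/-- A continuous curve that starts in a ball and that cannot reach the boundary of the ball
before leaving it stays in the ball. -/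
theorem forall_mem_ball_of_forall_norm_sub_lt {E : Type*} [NormedAddCommGroup E] {p : ℝ → E}
    {x₀ : E} {R : ℝ} (hpc : ContinuousOn p (Ici 0)) (h0 : p 0 ∈ ball x₀ R)
    (hT : ∀ T, 0 ≤ T → (∀ t ∈ Icc 0 T, p t ∈ closedBall x₀ R) → p T ∈ ball x₀ R) :
    ∀ t, 0 ≤ t → p t ∈ ball x₀ R := by
  by_contra! hcon
  obtain ⟨t₁, ht₁, hout⟩ := hcon
  have hdc : ContinuousOn (fun t => dist (p t) x₀) (Ici 0) :=
    continuous_dist.comp_continuousOn (hpc.prodMk continuousOn_const)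
  have hhit : ∀ t, 0 ≤ t → R ≤ dist (p t) x₀ → ∃ s ∈ Icc 0 t, dist (p s) x₀ = R := by
    intro t ht hR
    exact intermediate_value_Icc ht (hdc.mono Icc_subset_Ici_self) ⟨(mem_ball.1 h0).le, hR⟩
  have hout' : R ≤ dist (p t₁) x₀ := by simpa using hout
  have hcpt : IsCompact (Icc 0 t₁ ∩ (fun t => dist (p t) x₀) ⁻¹' {R}) :=
    isCompact_Icc.of_isClosed_subset ((hdc.mono Icc_subset_Ici_self).preimage_isClosed_of_isClosed
      isClosed_Icc isClosed_singleton) inter_subset_left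
  -- `T` is the first time on the sphere. Up to `T` the curve is in the closed ball, since leaving
  -- it would force an earlier crossing.
  obtain ⟨T, ⟨hTI, hTR⟩, hTmin⟩ := hcpt.exists_isLeast (by
    obtain ⟨s, hs, hsR⟩ := hhit t₁ ht₁ hout'
    exact ⟨s, hs, hsR⟩)
  have hTR' : dist (p T) x₀ = R := hTR
  refine (mem_ball.1 (hT T hTI.1 fun t ht => ?_)).ne hTR'
  by_contra hnot
  have hlt : R < dist (p t) x₀ := by simpa using hnot
  obtain ⟨s, hs, hsR⟩ := hhit t ht.1 hlt.le
  have hsT : T ≤ s := hTmin ⟨⟨hs.1, hs.2.trans (ht.2.trans hTI.2)⟩, hsR⟩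
  have : t = T := le_antisymm ht.2 (hsT.trans hs.2)
  rw [this, hTR'] at hlt
  exact lt_irrefl _ hlt

/-- A curve with exponentially small tails converges exponentially fast. -/
theorem exists_norm_sub_le_mul_exp {E : Type*} [NormedAddCommGroup E] [CompleteSpace E]
    {p : ℝ → E} {M γ : ℝ} (hγ : 0 < γ) 
    (h : ∀ t₁ t₂, 0 ≤ t₁ → t₁ ≤ t₂ → ‖p t₂ - p t₁‖ ≤ M * Real.exp (-γ * t₁)) :
    ∃ x, Filter.Tendsto p Filter.atTop (𝓝 x) ∧
      ∀ t, 0 ≤ t → ‖p t - x‖ ≤ M * Real.exp (-γ * t) := by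
  have hlim : Filter.Tendsto (fun t : ℝ => M * Real.exp (-γ * t)) Filter.atTop (𝓝 0) := by
    have h1 : Filter.Tendsto (fun t : ℝ => -γ * t) Filter.atTop Filter.atBot :=
      Filter.tendsto_id.const_mul_atTop_of_neg (neg_lt_zero.2 hγ)
    simpa using (Real.tendsto_exp_atBot.comp h1).const_mul M
  have hcau : Cauchy (Filter.map p Filter.atTop) := by
    rw [Metric.cauchy_iff]
    refine ⟨Filter.map_neBot, fun ε hε => ?_⟩
    obtain ⟨t₀, ht₀, ht₀'⟩ := ((hlim.eventually (gt_mem_nhds (half_pos hε))).and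
      (Filter.eventually_ge_atTop 0)).exists
    refine ⟨p '' Ici t₀, Filter.image_mem_map (Filter.Ici_mem_atTop t₀), ?_⟩
    rintro _ ⟨s, hs, rfl⟩ _ ⟨t, ht, rfl⟩
    have h1 := h t₀ s ht₀' hs
    have h2 := h t₀ t ht₀' ht
    rw [← dist_eq_norm] at h1 h2
    linarith [dist_triangle_right (p s) (p t) (p t₀)]
  obtain ⟨x, hx⟩ := CompleteSpace.complete hcau
  have hx' : Filter.Tendsto p Filter.atTop (𝓝 x) := hx
  refine ⟨x, hx', fun t ht => ?_⟩
  rw [norm_sub_rev]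
  refine le_of_tendsto (hx'.sub_const (p t)).norm ?_
  filter_upwards [Filter.eventually_ge_atTop t] with s hs
  exact h t s ht hs

/-- Local exponential convergence of the negative gradient flow of an energy `V` that satisfies
a Polyak–Łojasiewicz inequality near one of its zeros `x₀`. -/
theorem gradientFlow_locally_exp_converges {E : Type*} [NormedAddCommGroup E]
    [InnerProductSpace ℝ E] [FiniteDimensional ℝ E] {V : E → ℝ} {f : E → E} {χ ψ : Set E}
    {x₀ : E} {c L : ℝ} (hc : 0 < c) (hL : 0 ≤ L) (hV : ContDiffAt ℝ 2 V x₀) (hV0 : V x₀ = 0)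
    (hVnonneg : ∀ x, 0 ≤ V x)
    (hf : ∀ᶠ x in 𝓝 x₀, f x = -gradient V x)
    (hlow : ∀ᶠ x in 𝓝 x₀, c * V x ≤ ‖gradient V x‖ ^ 2)
    (hup : ∀ᶠ x in 𝓝 x₀, ‖gradient V x‖ ^ 2 ≤ L * V x)
    (hψ : ∀ᶠ x in 𝓝 x₀, V x = 0 → x ∈ ψ) (hχ : χ ∈ 𝓝 x₀) :
    ∃ B ∈ 𝓝 x₀, ∃ γ > (0 : ℝ), ∃ C : ℝ, ∀ p₀ ∈ B,
      (∃ p : ℝ → E, p 0 = p₀ ∧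
        ∀ t : ℝ, 0 ≤ t → p t ∈ χ ∧ HasDerivWithinAt p (f (p t)) (Ici 0) t) ∧
      ∀ p : ℝ → E, p 0 = p₀ →
        (∀ t : ℝ, 0 ≤ t → p t ∈ χ ∧ HasDerivWithinAt p (f (p t)) (Ici 0) t) →
        ∃ x ∈ ψ, ∀ t : ℝ, 0 ≤ t → ‖p t - x‖ ≤ C * Real.exp (-γ * t) := by
  have hdiff : ∀ᶠ x in 𝓝 x₀, DifferentiableAt ℝ V x :=
    (hV.eventually (by simp)).mono fun x hx => hx.differentiableAt (by simp)
  have hfC : ContDiffAt ℝ 1 f x₀ := by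
    have h1 : ContDiffAt ℝ 1 (fderiv ℝ V) x₀ := hV.fderiv_right (by norm_num)
    have h2 : ContDiffAt ℝ 1 (fun x => -gradient V x) x₀ :=
      ((InnerProductSpace.toDual ℝ E).symm.contDiff.contDiffAt.comp x₀ h1).neg
    exact h2.congr_of_eventuallyEq hf
  have hfC' : ∀ᶠ x in 𝓝 x₀, ContDiffAt ℝ 1 f x := hfC.eventually (by simp)
  obtain ⟨R, hR, hball⟩ := Metric.nhds_basis_closedBall.mem_iff.1
    (Filter.inter_mem (hdiff.and (hf.and (hlow.and (hup.and (hψ.and hfC'))))) hχ)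
  have hprop := fun x hx => (hball (a := x) hx).1
  have hχR := fun x hx => (hball (a := x) hx).2
  simp only [mem_ofPred_eq] at hprop
  have hVf : ∀ x ∈ closedBall x₀ R, fderiv ℝ V x (f x) = -‖f x‖ ^ 2 := by
    intro x hx
    obtain ⟨-, h2, -⟩ := hprop x hx
    have : fderiv ℝ V x (f x) = inner ℝ (gradient V x) (f x) := by
      rw [gradient, InnerProductSpace.toDual_symm_apply]
    rw [this, h2, inner_neg_right, real_inner_self_eq_norm_sq, norm_neg]
  have hnorm : ∀ x ∈ closedBall x₀ R, ‖f x‖ = ‖gradient V x‖ := fun x hx => by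
    rw [(hprop x hx).2.1, norm_neg]
  have hmono : ∀ r ≤ R, closedBall x₀ r ⊆ closedBall x₀ R := fun r hr =>
    closedBall_subset_closedBall hr
  have hest := fun (p : ℝ → E) (T : ℝ) (r : ℝ) (hr : r ≤ R) => norm_sub_le_of_energy (V := V)
    (V' := fderiv ℝ V) (f := f) (s := closedBall x₀ r) (p := p) (T := T) hc
    (fun x hx => (hprop x (hmono r hr hx)).1.hasFDerivAt) (fun x hx => hVf x (hmono r hr hx))
    (fun x hx => by rw [hnorm x (hmono r hr hx)]; exact (hprop x (hmono r hr hx)).2.2.1)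
    (fun x hx => by rw [hnorm x (hmono r hr hx)]; exact (hprop x (hmono r hr hx)).2.2.2.1) hL
  have hVc : ContinuousAt V x₀ := hV.continuousAt
  -- The gap between `r` and `R` leaves room for a cutoff that is `1` on the smaller ball.
  set r := R / 2 with hr
  have hr0 : 0 < r := half_pos hR
  have hrR : r ≤ R := by linarith
  -- Half of `r` is spent on the initial distance and half on the length of the trajectory.
  have hB : ∀ᶠ x in 𝓝 x₀, x ∈ ball x₀ (r / 2) ∧ 2 / c * √(L * V x) < r / 2 := by
    refine Filter.Eventually.and (ball_mem_nhds x₀ (half_pos hr0)) ?_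
    have : ContinuousAt (fun x => 2 / c * √(L * V x)) x₀ := by fun_prop
    exact this.eventually (gt_mem_nhds (by simpa [hV0] using hr0))
  have hstay : ∀ p : ℝ → E, p 0 ∈ ball x₀ (r / 2) → 2 / c * √(L * V (p 0)) < r / 2 →
      ContinuousOn p (Ici 0) →
      (∀ t, 0 ≤ t → p t ∈ closedBall x₀ r → HasDerivWithinAt p (f (p t)) (Ici 0) t) →
      ∀ t, 0 ≤ t → p t ∈ ball x₀ r := by
    intro p h0 h0' hpc hp
    refine forall_mem_ball_of_forall_norm_sub_lt hpc
      (ball_subset_ball (by linarith) h0) fun T hT hin => ?_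
    have := hest p T r hrR hin (fun t ht => hp t ht.1 (hin t ht)) le_rfl hT le_rfl
    rw [← dist_eq_norm] at this
    have h1 : Real.exp (-(c / 2) * 0) - Real.exp (-(c / 2) * T) ≤ 1 := by
      simpa using (Real.exp_pos _).le
    have h2 : dist (p T) (p 0) ≤ 2 / c * √(L * V (p 0)) * 1 :=
      this.trans (mul_le_mul_of_nonneg_left h1 (by positivity))
    rw [mem_ball] at h0 ⊢
    linarith [dist_triangle (p T) (p 0) x₀]
  refine ⟨_, hB, c / 2, half_pos hc, r / 2, fun p₀ hp₀ => ⟨?_, ?_⟩⟩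
  -- The cut-off field is compactly supported and C¹, hence bounded and Lipschitz; its solution
  -- never leaves the ball where it agrees with `f`.
  · let φ : ContDiffBump x₀ := ⟨r, R, hr0, half_lt_self hR⟩
    have htsup : ∀ x ∈ tsupport (fun x => φ x • f x), x ∈ closedBall x₀ R := fun x hx => by
      rw [← φ.tsupport_eq]
      exact tsupport_smul_subset_left φ f hx
    have hg : ContDiff ℝ 1 (fun x => φ x • f x) :=
      contMDiff_iff_contDiff.1 <| contMDiff_of_tsupport fun x hx =>
        (φ.contDiffAt.smul (hprop x (htsup x hx)).2.2.2.2.2).contMDiffAt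
    have hgc : HasCompactSupport (fun x => φ x • f x) := φ.hasCompactSupport.smul_right
    obtain ⟨K, hK⟩ := hg.lipschitzWith_of_hasCompactSupport hgc (by simp)
    obtain ⟨M, hM⟩ := hg.continuous.bounded_above_of_compact_support hgc
    obtain ⟨p, hp0, hp⟩ := exists_forall_hasDerivAt_of_lipschitzWith hK (L := M.toNNReal)
      (fun x => (hM x).trans (Real.le_coe_toNNReal M)) p₀
    have hpf : ∀ t, 0 ≤ t → p t ∈ closedBall x₀ r →
        HasDerivWithinAt p (f (p t)) (Ici 0) t := fun t _ ht => by
      have := (hp t).hasDerivWithinAt (s := Ici 0)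
      rwa [φ.one_of_mem_closedBall ht, one_smul] at this
    have hin := hstay p (hp0 ▸ hp₀.1) (hp0 ▸ hp₀.2)
      (fun t _ => (hp t).continuousAt.continuousWithinAt) hpf
    exact ⟨p, hp0, fun t ht => ⟨hχR _ (hmono r hrR (ball_subset_closedBall (hin t ht))),
      hpf t ht (ball_subset_closedBall (hin t ht))⟩⟩
  · rintro p rfl hp
    have hin := hstay p hp₀.1 hp₀.2 (fun t ht => (hp t ht).2.continuousWithinAt)
      (fun t ht _ => (hp t ht).2)
    have htail : ∀ t₁ t₂, 0 ≤ t₁ → t₁ ≤ t₂ →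
        ‖p t₂ - p t₁‖ ≤ r / 2 * Real.exp (-(c / 2) * t₁) := by
      intro t₁ t₂ h₁ h₁₂
      refine (hest p t₂ r hrR (fun t ht => ball_subset_closedBall (hin t ht.1))
        (fun t ht => (hp t ht.1).2) h₁ h₁₂ le_rfl).trans ?_
      exact mul_le_mul hp₀.2.le (by linarith [Real.exp_pos (-(c / 2) * t₂)])
        (sub_nonneg.2 (Real.exp_le_exp.2 (by nlinarith))) (by positivity)
    obtain ⟨x, hx, hxt⟩ := exists_norm_sub_le_mul_exp (half_pos hc) htail
    have hxball : x ∈ closedBall x₀ R := by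
      refine hmono r hrR (isClosed_closedBall.mem_of_tendsto hx ?_)
      filter_upwards [Filter.eventually_ge_atTop 0] with t ht
      exact ball_subset_closedBall (hin t ht)
    refine ⟨x, (hprop x hxball).2.2.2.2.1 ?_, hxt⟩
    refine le_antisymm ?_ (hVnonneg x)
    have h1 : Filter.Tendsto (fun t : ℝ => V (p 0) * Real.exp (-(c * t))) Filter.atTop (𝓝 0) := by
      have h2 : Filter.Tendsto (fun t : ℝ => -(c * t)) Filter.atTop Filter.atBot :=
        Filter.tendsto_neg_atTop_atBot.comp (Filter.tendsto_id.const_mul_atTop hc)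
      simpa using (Real.tendsto_exp_atBot.comp h2).const_mul (V (p 0))
    refine le_of_tendsto_of_tendsto ((hprop x hxball).1.continuousAt.tendsto.comp hx) h1 ?_
    filter_upwards [Filter.eventually_ge_atTop 0] with t ht
    exact energy_mul_exp_le (V := V) (V' := fderiv ℝ V) (f := f) (s := closedBall x₀ R)
      (fun x hx => (hprop x hx).1.hasFDerivAt) hVf
      (fun x hx => by rw [hnorm x hx]; exact (hprop x hx).2.2.1)
      (fun s hs => hmono r hrR (ball_subset_closedBall (hin s hs.1))) (fun s hs => (hp s hs.1).2)
      t ⟨ht, le_rfl⟩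

end Flow

end Formation

namespace Formation

/-! ### Least-squares energies and the slice inequality. -/

section Energy

variable {E H : Type*} [NormedAddCommGroup H]

/-- The energy `½ ‖F(x) - y‖²`. -/
noncomputable def energy (F : E → H) (y : H) (x : E) : ℝ := 1 / 2 * ‖F x - y‖ ^ 2

theorem energy_nonneg (F : E → H) (y : H) (x : E) : 0 ≤ energy F y x := by
  unfold energy; positivity

variable [NormedAddCommGroup E] [InnerProductSpace ℝ E] [InnerProductSpace ℝ H]

theorem contDiffAt_energy {F : E → H} {y : H} {x : E} {n : WithTop ℕ∞} (hF : ContDiffAt ℝ n F x) :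
    ContDiffAt ℝ n (energy F y) x :=
  contDiffAt_const.mul ((hF.sub contDiffAt_const).norm_sq ℝ)

variable [FiniteDimensional ℝ E]

theorem inner_gradient_energy {F : E → H} {y : H} {x : E} (hF : DifferentiableAt ℝ F x) (v : E) :
    inner ℝ (gradient (energy F y) x) v = inner ℝ (F x - y) (fderiv ℝ F x v) := by
  have h : HasFDerivAt (energy F y) _ x := ((hF.hasFDerivAt.sub_const y).norm_sq).const_mul (1 / 2)
  rw [gradient, InnerProductSpace.toDual_symm_apply, h.fderiv]
  simp [inner_sub_left]

/-- Pair the gradient with itself, apply Cauchy–Schwarz, and cancel one factor. -/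
theorem norm_gradient_energy_le {F : E → H} {y : H} {x : E} (hF : DifferentiableAt ℝ F x) :
    ‖gradient (energy F y) x‖ ^ 2 ≤ 2 * ‖fderiv ℝ F x‖ ^ 2 * energy F y x := by
  have h : ‖gradient (energy F y) x‖ * ‖gradient (energy F y) x‖ ≤
      (‖F x - y‖ * ‖fderiv ℝ F x‖) * ‖gradient (energy F y) x‖ := by
    rw [← real_inner_self_eq_norm_mul_norm, inner_gradient_energy hF, mul_assoc]
    exact (real_inner_le_norm _ _).trans
      (mul_le_mul_of_nonneg_left (ContinuousLinearMap.le_opNorm _ _) (norm_nonneg _))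
  have h' : ‖gradient (energy F y) x‖ ≤ ‖F x - y‖ * ‖fderiv ℝ F x‖ := by
    rcases (norm_nonneg (gradient (energy F y) x)).eq_or_lt with h0 | h0
    · rw [← h0]; positivity
    · exact le_of_mul_le_mul_right h h0
  calc ‖gradient (energy F y) x‖ ^ 2 ≤ (‖F x - y‖ * ‖fderiv ℝ F x‖) ^ 2 := by gcongr
    _ = _ := by unfold energy; ring

/-- If a linear map is injective on `N` then it is bounded below on `N`. -/
theorem exists_mul_norm_le_of_ker_inf_eq_bot (J : E →L[ℝ] H) {N : Submodule ℝ E}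
    (hJ : ∀ v ∈ N, J v = 0 → v = 0) : ∃ σ > (0 : ℝ), ∀ v ∈ N, σ * ‖v‖ ≤ ‖J v‖ := by
  obtain ⟨K, hK, hKJ⟩ := ((J : E →ₗ[ℝ] H).domRestrict N).exists_antilipschitzWith (by
    rw [LinearMap.ker_eq_bot']
    intro v hv
    exact Subtype.ext (hJ v v.2 hv))
  refine ⟨(K : ℝ)⁻¹, by positivity, fun v hv => ?_⟩
  rw [inv_mul_le_iff₀ (by exact_mod_cast hK)]
  simpa using hKJ.le_mul_norm (map_zero _) ⟨v, hv⟩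

/-- **Polyak–Łojasiewicz inequality from a slice.** Let `F` be invariant under a family of affine
maps whose orbits through the slice `x₀ + N` cover a neighbourhood of `x₁`, and let the derivative
of `F` at `x₀` be injective on `N`. Then the energy `½ ‖F - F(x₀)‖²` is dominated by the squared
norm of its gradient near `x₁`, and vanishes only on the orbit of `x₀`. -/
theorem exists_energy_le_norm_gradient_sq {F : E → H} {x₀ x₁ : E} {N : Submodule ℝ E} {ψ : Set E}
    {C : ℝ} (hF₀ : ContDiffAt ℝ 1 F x₀) (hF₁ : ∀ᶠ x in 𝓝 x₁, DifferentiableAt ℝ F x)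
    (hN : ∀ v ∈ N, fderiv ℝ F x₀ v = 0 → v = 0) (hC : 0 < C)
    (hslice : ∀ U ∈ 𝓝 (0 : E), ∀ᶠ x in 𝓝 x₁, ∃ s ∈ N, s ∈ U ∧ ∃ (g : E →L[ℝ] E) (b : E),
      ‖g‖ ≤ C ∧ x = g (x₀ + s) + b ∧ (∀ z, F (g z + b) = F z) ∧ g x₀ + b ∈ ψ) :
    ∃ c > (0 : ℝ), ∀ᶠ x in 𝓝 x₁, c * energy F (F x₀) x ≤ ‖gradient (energy F (F x₀)) x‖ ^ 2 ∧
      (energy F (F x₀) x = 0 → x ∈ ψ) := by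
  obtain ⟨σ, hσ, hσN⟩ := exists_mul_norm_le_of_ker_inf_eq_bot (fderiv ℝ F x₀) hN
  have hd : HasFDerivAt F (fderiv ℝ F x₀) x₀ := (hF₀.differentiableAt (by simp)).hasFDerivAt
  -- With `σ‖s‖ ≤ ‖A‖`, the tolerance `σ / 8` turns both linearization errors into at most `‖A‖ /
  -- 8`.
  have hU₁ : ∀ᶠ s in 𝓝 (0 : E), ‖F (x₀ + s) - F x₀ - fderiv ℝ F x₀ s‖ ≤ σ / 8 * ‖s‖ :=
    (hasFDerivAt_iff_isLittleO_nhds_zero.1 hd).def (by positivity)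
  have hadd : Filter.Tendsto (fun s : E => x₀ + s) (𝓝 0) (𝓝 x₀) :=
    Continuous.tendsto' (by fun_prop) _ _ (add_zero x₀)
  have hU₂ : ∀ᶠ s in 𝓝 (0 : E), ‖fderiv ℝ F (x₀ + s) - fderiv ℝ F x₀‖ < σ / 8 := by
    have h : ContinuousAt (fderiv ℝ F) x₀ := (hF₀.fderiv_right (m := 0) (by simp)).continuousAt
    have := (h.tendsto.comp hadd).sub_const (fderiv ℝ F x₀) |>.norm
    exact this.eventually (gt_mem_nhds (by simpa using hσ))
  refine ⟨σ ^ 2 / (4 * C ^ 2), by positivity, ?_⟩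
  filter_upwards [hslice _ (hU₁.and hU₂), hF₁] with x ⟨s, hsN, ⟨hs₁, hs₂⟩, g, b, hg, hx, hinv, hψ⟩
    hFx
  have hFs : F x = F (x₀ + s) := by rw [hx, hinv]
  have hσs := hσN s hsN
  set A := fderiv ℝ F x₀ s with hA
  have hr₁ : ‖F x - F x₀ - A‖ ≤ ‖A‖ / 8 := by rw [hFs]; linarith
  have hr₂ : ‖fderiv ℝ F (x₀ + s) s - A‖ ≤ ‖A‖ / 8 := by
    have := (fderiv ℝ F (x₀ + s) - fderiv ℝ F x₀).le_of_opNorm_le hs₂.le s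
    rw [sub_apply, ← hA] at this
    linarith
  have he : ‖F x - F x₀‖ ≤ 9 / 8 * ‖A‖ := by
    have := norm_le_norm_add_norm_sub' (F x - F x₀) A
    linarith
  constructor
  -- Differentiate the invariance `F (g z + b) = F z` at `z = x₀ + s`.
  · have hchain : fderiv ℝ F x (g s) = fderiv ℝ F (x₀ + s) s := by
      have hg' : HasFDerivAt (fun z => g z + b) g (x₀ + s) := g.hasFDerivAt.add_const b
      have h1 : HasFDerivAt (fun z => F (g z + b)) ((fderiv ℝ F x).comp g) (x₀ + s) := by
        refine HasFDerivAt.comp (x₀ + s) ?_ hg'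
        rw [← hx]
        exact hFx.hasFDerivAt
      have h2 : HasFDerivAt F ((fderiv ℝ F x).comp g) (x₀ + s) := by
        simpa only [hinv] using h1
      rw [h2.fderiv]
      rfl
    -- Both vectors are close to `A`; the error terms cost at most `1/8 + 1/8 + 1/64` of `‖A‖²`.
    have hinner : ‖A‖ ^ 2 / 2 ≤ inner ℝ (F x - F x₀) (fderiv ℝ F (x₀ + s) s) := by
      have h1 : inner ℝ (F x - F x₀) (fderiv ℝ F (x₀ + s) s) = inner ℝ A A +
          inner ℝ A (fderiv ℝ F (x₀ + s) s - A) + inner ℝ (F x - F x₀ - A) A +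
          inner ℝ (F x - F x₀ - A) (fderiv ℝ F (x₀ + s) s - A) := by
        simp only [inner_sub_left, inner_sub_right]; ring
      rw [h1, real_inner_self_eq_norm_sq]
      have h2 := abs_le.1 ((abs_real_inner_le_norm A (fderiv ℝ F (x₀ + s) s - A)).trans
        (mul_le_mul_of_nonneg_left hr₂ (norm_nonneg A)))
      have h3 := abs_le.1 ((abs_real_inner_le_norm (F x - F x₀ - A) A).trans
        (mul_le_mul_of_nonneg_right hr₁ (norm_nonneg A)))
      have h4 := abs_le.1 ((abs_real_inner_le_norm (F x - F x₀ - A)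
        (fderiv ℝ F (x₀ + s) s - A)).trans
          (mul_le_mul hr₁ hr₂ (norm_nonneg _) (by positivity)))
      nlinarith [h2.1, h3.1, h4.1, sq_nonneg ‖A‖]
    -- The test direction is `g s`, of norm at most `C‖s‖ ≤ C‖A‖/σ`.
    have hgrad : ‖A‖ ^ 2 / 2 ≤ ‖gradient (energy F (F x₀)) x‖ * (C * (‖A‖ / σ)) := by
      refine hinner.trans ?_
      rw [← hchain, ← inner_gradient_energy hFx]
      refine (real_inner_le_norm _ _).trans (mul_le_mul_of_nonneg_left ?_ (norm_nonneg _))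
      refine (g.le_of_opNorm_le hg s).trans (mul_le_mul_of_nonneg_left ?_ hC.le)
      rw [le_div_iff₀ hσ]
      linarith
    have hlow : σ / (2 * C) * ‖A‖ ≤ ‖gradient (energy F (F x₀)) x‖ := by
      rcases (norm_nonneg A).eq_or_lt with h0 | h0
      · rw [← h0]; simp
      · refine le_of_mul_le_mul_right (a := C * (‖A‖ / σ)) ?_ (by positivity)
        refine le_trans (le_of_eq ?_) hgrad
        field_simp
    have hen : energy F (F x₀) x ≤ ‖A‖ ^ 2 := by
      unfold energy
      nlinarith [norm_nonneg (F x - F x₀), norm_nonneg A]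
    calc σ ^ 2 / (4 * C ^ 2) * energy F (F x₀) x ≤ σ ^ 2 / (4 * C ^ 2) * ‖A‖ ^ 2 := by gcongr
      _ = (σ / (2 * C) * ‖A‖) ^ 2 := by ring
      _ ≤ _ := by gcongr
  -- A zero residual gives `‖A‖ ≤ ‖A‖ / 8`, so `A = 0` and then `s = 0`.
  · intro h0
    have h1 : F x - F x₀ = 0 := by simpa [energy] using h0
    rw [h1, zero_sub, norm_neg] at hr₁
    have h2 : s = 0 := by
      rw [← norm_le_zero_iff]
      have : σ * ‖s‖ ≤ σ * 0 := by rw [mul_zero]; linarith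
      exact le_of_mul_le_mul_left this hσ
    rw [hx, h2, add_zero]
    exact hψ

end Energy

end Formation

namespace Formation
noncomputable section
variable {n d : ℕ}

/-! ### Similarities, trivial motions and the slice. -/

section Similarity

/-- The action of a matrix on each agent's position. -/
def matrixAction (n d : ℕ) : Matrix (Fin d) (Fin d) ℝ →ₗ[ℝ] Config n d →L[ℝ] Config n d where
  toFun M := LinearMap.toContinuousLinearMap
    { toFun := fun p => WithLp.toLp 2 fun ia => M.mulVec (pos p ia.1).ofLp ia.2
      map_add' := fun p q => by
        ext ia
        exact congrFun (M.mulVec_add (pos p ia.1).ofLp (pos q ia.1).ofLp) ia.2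
      map_smul' := fun c p => by
        ext ia
        exact congrFun (M.mulVec_smul c (pos p ia.1).ofLp) ia.2 }
  map_add' M M' := by
    ext p ia
    exact congrFun (M.add_mulVec M' (pos p ia.1).ofLp) ia.2
  map_smul' c M := by
    ext p ia
    exact congrFun (Matrix.smul_mulVec c M (pos p ia.1).ofLp) ia.2

/-- The configuration with all agents at the same position. -/
def constConfig (n d : ℕ) : EuclideanSpace ℝ (Fin d) →L[ℝ] Config n d :=
  LinearMap.toContinuousLinearMap
    { toFun := fun b => WithLp.toLp 2 fun ia => b ia.2
      map_add' := fun _ _ => rfl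
      map_smul' := fun _ _ => rfl }

@[simp] theorem pos_matrixAction (M : Matrix (Fin d) (Fin d) ℝ) (p : Config n d) (i : Fin n) :
    pos (matrixAction n d M p) i = WithLp.toLp 2 (M.mulVec (pos p i).ofLp) := rfl

@[simp] theorem pos_constConfig (b : EuclideanSpace ℝ (Fin d)) (i : Fin n) :
    pos (constConfig n d b) i = b := rfl

@[simp] theorem pos_add (p q : Config n d) (i : Fin n) : pos (p + q) i = pos p i + pos q i := rfl

@[simp] theorem pos_smul (c : ℝ) (p : Config n d) (i : Fin n) : pos (c • p) i = c • pos p i := rfl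

theorem config_ext {p q : Config n d} (h : ∀ i, pos p i = pos q i) : p = q := by
  ext ⟨i, a⟩
  exact congrArg (fun v : EuclideanSpace ℝ (Fin d) => v a) (h i)

theorem matrixAction_mul (M M' : Matrix (Fin d) (Fin d) ℝ) (p : Config n d) :
    matrixAction n d (M * M') p = matrixAction n d M (matrixAction n d M' p) :=
  config_ext fun i => by simp [Matrix.mulVec_mulVec]

theorem matrixAction_one (p : Config n d) : matrixAction n d 1 p = p :=
  config_ext fun i => by simp

theorem matrixAction_constConfig (M : Matrix (Fin d) (Fin d) ℝ) (b : EuclideanSpace ℝ (Fin d)) :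
    matrixAction n d M (constConfig n d b) = constConfig n d (WithLp.toLp 2 (M.mulVec b.ofLp)) :=
  rfl

theorem mem_similarityClass_iff {p q : Config n d} : q ∈ similarityClass p ↔
    ∃ (c : ℝ) (Q : Matrix (Fin d) (Fin d) ℝ) (b : EuclideanSpace ℝ (Fin d)), 0 < c ∧
      Q ∈ Matrix.specialOrthogonalGroup (Fin d) ℝ ∧
      q = (c • matrixAction n d Q) p + constConfig n d b := by
  constructor
  · rintro ⟨c, Q, b, hc, hQ, h⟩
    exact ⟨c, Q, b, hc, hQ, config_ext fun i => by simpa using h i⟩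
  · rintro ⟨c, Q, b, hc, hQ, rfl⟩
    exact ⟨c, Q, b, hc, hQ, fun i => by simp⟩

/-- The skew-symmetric matrix `M - Mᵀ`. -/
def skewPart (d : ℕ) : Matrix (Fin d) (Fin d) ℝ →ₗ[ℝ] Matrix (Fin d) (Fin d) ℝ where
  toFun M := M - M.transpose
  map_add' M N := by rw [Matrix.transpose_add]; abel
  map_smul' r M := by simp [smul_sub]

theorem skewPart_apply (M : Matrix (Fin d) (Fin d) ℝ) : skewPart d M = M - M.transpose := rfl

/-- Parametrization of the trivial motions of `p`; the rotational part is `M - Mᵀ`. -/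
def trivialMotionMap (p : Config n d) :
    (EuclideanSpace ℝ (Fin d) × Matrix (Fin d) (Fin d) ℝ × ℝ) →ₗ[ℝ] Config n d where
  toFun u := constConfig n d u.1 + matrixAction n d (skewPart d u.2.1) p + u.2.2 • p
  map_add' u v := by
    simp only [map_add, Prod.fst_add, Prod.snd_add, add_smul, add_apply]
    abel
  map_smul' r u := by simp [smul_smul]

theorem IsTrivialMotion.mem_range {p v : Config n d} (h : IsTrivialMotion p v) :
    v ∈ LinearMap.range (trivialMotionMap p) := by
  obtain ⟨b, Ω, c, hΩ, hv⟩ := h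
  -- The half compensates for `Ω - Ωᵀ = 2Ω`.
  refine ⟨(b, (1 / 2 : ℝ) • Ω, c), config_ext fun i => ?_⟩
  have h1 : (1 / 2 : ℝ) • Ω - ((1 / 2 : ℝ) • Ω).transpose = Ω := by
    rw [Matrix.transpose_smul, hΩ, smul_neg, sub_neg_eq_add, ← add_smul]
    norm_num
  rw [hv]
  simp only [trivialMotionMap, LinearMap.coe_mk, AddHom.coe_mk, skewPart_apply, h1]
  simp

/-- Transposing inverts the exponential, which gives orthogonality. The determinant is the square of
that of the orthogonal matrix `exp (M/2)`, which excludes `-1`. -/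
theorem exp_mem_specialOrthogonalGroup {M : Matrix (Fin d) (Fin d) ℝ} (hM : M.transpose = -M) :
    NormedSpace.exp M ∈ Matrix.specialOrthogonalGroup (Fin d) ℝ := by
  have horth : ∀ N : Matrix (Fin d) (Fin d) ℝ, N.transpose = -N →
      (NormedSpace.exp N).transpose * NormedSpace.exp N = 1 := by
    intro N hN
    rw [← Matrix.exp_transpose, hN, Matrix.exp_neg]
    exact Matrix.nonsing_inv_mul _ ((Matrix.isUnit_iff_isUnit_det _).1 (Matrix.isUnit_exp N))
  rw [Matrix.mem_specialOrthogonalGroup_iff]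
  refine ⟨(Matrix.mem_orthogonalGroup_iff' (Fin d) ℝ).2 (horth M hM), ?_⟩
  have h1 : NormedSpace.exp M = NormedSpace.exp ((1 / 2 : ℝ) • M) ^ 2 := by
    rw [← Matrix.exp_nsmul]
    congr 1
    rw [← Nat.cast_smul_eq_nsmul ℝ, smul_smul]
    norm_num
  have h2 := congrArg Matrix.det (horth ((1 / 2 : ℝ) • M) (by simp [hM]))
  rw [Matrix.det_mul, Matrix.det_transpose, Matrix.det_one] at h2
  rw [h1, Matrix.det_pow, sq, h2]

attribute [local instance] Matrix.linftyOpNormedRing Matrix.linftyOpNormedAlgebra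

/-- Parameters of a similarity together with a displacement in the slice `(T_p)ᗮ`, where `T_p` is
the space of trivial motions of `p`. -/
abbrev SliceParam (p : Config n d) : Type :=
  (EuclideanSpace ℝ (Fin d) × Matrix (Fin d) (Fin d) ℝ × ℝ) ×
    (LinearMap.range (trivialMotionMap p))ᗮ

/-- The similarities `(1 + c) exp(M - Mᵀ) x + b` applied to the points of the slice
`p + (T_p)ᗮ`. -/
def sliceMap (p : Config n d) (u : SliceParam p) : Config n d :=
  ((1 + u.1.2.2) • matrixAction n d (NormedSpace.exp (skewPart d u.1.2.1))) (p + u.2) +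
    constConfig n d u.1.1

/-- The strict derivative at `0` adds a trivial motion and a vector of its orthogonal complement, so
it is surjective and the map is locally open. Injectivity is not needed, which permits the redundant
parameter `M` for rotations. -/
theorem map_nhds_sliceMap (p : Config n d) :
    Filter.map (sliceMap p) (𝓝 0) = 𝓝 p := by
  let params : SliceParam p →L[ℝ] EuclideanSpace ℝ (Fin d) × Matrix (Fin d) (Fin d) ℝ × ℝ :=
    ContinuousLinearMap.fst ℝ _ _
  let tr := (ContinuousLinearMap.fst ℝ _ _).comp params
  let scal := ((ContinuousLinearMap.snd ℝ _ _).comp (ContinuousLinearMap.snd ℝ _ _)).comp params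
  let skew := (LinearMap.toContinuousLinearMap (skewPart d)).comp
    (((ContinuousLinearMap.fst ℝ _ _).comp (ContinuousLinearMap.snd ℝ _ _)).comp params)
  let sl : SliceParam p →L[ℝ] Config n d :=
    (Submodule.subtypeL _).comp (ContinuousLinearMap.snd ℝ _ _)
  let act : Matrix (Fin d) (Fin d) ℝ →L[ℝ] Config n d →L[ℝ] Config n d :=
    LinearMap.toContinuousLinearMap (matrixAction n d)
  have hexp : HasStrictFDerivAt (fun u : SliceParam p => NormedSpace.exp (skew u))
      ((1 : Matrix (Fin d) (Fin d) ℝ →L[ℝ] Matrix (Fin d) (Fin d) ℝ).comp skew) 0 := by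
    have h0 : skew 0 = 0 := map_zero _
    have := hasStrictFDerivAt_exp_zero (𝕂 := ℝ) (𝔸 := Matrix (Fin d) (Fin d) ℝ)
    rw [← h0] at this
    exact this.comp (0 : SliceParam p) skew.hasStrictFDerivAt
  have hder := ((((scal.hasStrictFDerivAt (x := 0)).const_add 1).smul
    (act.hasStrictFDerivAt.comp (0 : SliceParam p) hexp)).clm_apply
      ((sl.hasStrictFDerivAt (x := 0)).const_add p)).add
      ((constConfig n d).hasStrictFDerivAt.comp (0 : SliceParam p) tr.hasStrictFDerivAt)
  have hder' : HasStrictFDerivAt (sliceMap p)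
      ((LinearMap.toContinuousLinearMap (trivialMotionMap p)).comp params + sl) 0 := by
    refine HasStrictFDerivAt.congr_fderiv hder (ContinuousLinearMap.ext fun u => ?_)
    have h1 : act (NormedSpace.exp (skew 0)) = matrixAction n d 1 := by simp [act]
    have h2 : scal 0 = 0 := map_zero _
    have h3 : sl 0 = 0 := map_zero _
    simp only [add_apply, ContinuousLinearMap.flip_apply, Pi.smul_apply', h1, h2, h3, add_zero,
      one_smul]
    change matrixAction n d 1 (sl u) + (matrixAction n d (skewPart d u.1.2.1) p +
      u.1.2.2 • matrixAction n d 1 p) + constConfig n d u.1.1 =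
      constConfig n d u.1.1 + matrixAction n d (skewPart d u.1.2.1) p + u.1.2.2 • p + sl u
    rw [matrixAction_one, matrixAction_one]
    abel
  have hval : sliceMap p 0 = p := by
    simp [sliceMap, matrixAction_one]
  have := hder'.map_nhds_eq_of_surj ?_
  · rwa [hval] at this
  · rw [LinearMap.range_eq_top]
    intro w
    obtain ⟨y, ⟨u, rfl⟩, z, hz, rfl⟩ :=
      (LinearMap.range (trivialMotionMap p)).exists_add_mem_mem_orthogonal w
    exact ⟨(u, ⟨z, hz⟩), rfl⟩

/-- Near a configuration that is similar to `p`, every configuration is the image, under a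
similarity of bounded norm, of a point of the slice `p + (T_p)ᗮ` close to `p`. -/
theorem eventually_exists_similarity_slice (p : Config n d) {q : Config n d}
    (hq : q ∈ similarityClass p) : ∃ C > (0 : ℝ), ∀ U ∈ 𝓝 (0 : Config n d), ∀ᶠ x in 𝓝 q,
      ∃ s ∈ (LinearMap.range (trivialMotionMap p))ᗮ, s ∈ U ∧
        ∃ (c : ℝ) (Q : Matrix (Fin d) (Fin d) ℝ) (b : EuclideanSpace ℝ (Fin d)), 0 < c ∧
          Q ∈ Matrix.specialOrthogonalGroup (Fin d) ℝ ∧ ‖c • matrixAction n d Q‖ ≤ C ∧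
          x = (c • matrixAction n d Q) (p + s) + constConfig n d b := by
  obtain ⟨c, Q, b, hc, hQ, rfl⟩ := mem_similarityClass_iff.1 hq
  have hQ' : Q.transpose * Q = 1 ∧ Q * Q.transpose = 1 := by
    have := (Matrix.mem_specialOrthogonalGroup_iff.1 hQ).1
    exact ⟨(Matrix.mem_orthogonalGroup_iff' _ _).1 this, (Matrix.mem_orthogonalGroup_iff _ _).1 this⟩
  let act : Matrix (Fin d) (Fin d) ℝ →L[ℝ] Config n d →L[ℝ] Config n d :=
    LinearMap.toContinuousLinearMap (matrixAction n d)
  -- The factors bound the similarity taking `p` to the given point and one near the identity; the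
  -- last `+ 1` ensures positivity even if the norms vanish.
  refine ⟨c * ‖act Q‖ * (‖act 1‖ + 1) + 1, by positivity, fun U hU => ?_⟩
  have hbound : ∀ᶠ u in 𝓝 (0 : SliceParam p),
      ‖(1 + u.1.2.2) • act (NormedSpace.exp (skewPart d u.1.2.1))‖ < ‖act 1‖ + 1 := by
    have hcont : Continuous fun u : SliceParam p =>
        ‖(1 + u.1.2.2) • act (NormedSpace.exp (skewPart d u.1.2.1))‖ := by
      have hs : Continuous (skewPart d) := (skewPart d).continuous_of_finiteDimensional
      have : Continuous fun u : SliceParam p => NormedSpace.exp (skewPart d u.1.2.1) :=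
        NormedSpace.exp_continuous.comp (by fun_prop)
      fun_prop
    refine (hcont.tendsto 0).eventually (gt_mem_nhds ?_)
    simp
  have hpos : ∀ᶠ u in 𝓝 (0 : SliceParam p), 0 < 1 + u.1.2.2 := by
    have hcont : Continuous fun u : SliceParam p => 1 + u.1.2.2 := by fun_prop
    exact (hcont.tendsto 0).eventually (lt_mem_nhds (by simp))
  have hU' : ∀ᶠ u in 𝓝 (0 : SliceParam p), (u.2 : Config n d) ∈ U := by
    have hcont : Continuous fun u : SliceParam p => (u.2 : Config n d) := by fun_prop
    exact (hcont.tendsto 0).eventually (by simpa using hU)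
  have hnear : ∀ᶠ y in 𝓝 p, ∃ u : SliceParam p,
      ((‖(1 + u.1.2.2) • act (NormedSpace.exp (skewPart d u.1.2.1))‖ < ‖act 1‖ + 1 ∧
        0 < 1 + u.1.2.2) ∧ (u.2 : Config n d) ∈ U) ∧ sliceMap p u = y := by
    have := Filter.image_mem_map (m := sliceMap p) ((hbound.and hpos).and hU')
    rw [map_nhds_sliceMap] at this
    exact this
  -- The inverse similarity carries the problem back to a neighbourhood of `p`.
  have hback : Filter.Tendsto (fun x => c⁻¹ • act Q.transpose (x - constConfig n d b))
      (𝓝 ((c • matrixAction n d Q) p + constConfig n d b)) (𝓝 p) := by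
    refine Continuous.tendsto' (by fun_prop) _ _ ?_
    simp [act, smul_smul, hc.ne', ← matrixAction_mul, hQ'.1, matrixAction_one]
  filter_upwards [hback.eventually hnear] with x ⟨u, ⟨⟨hu₁, hu₂⟩, hu₃⟩, hux⟩
  refine ⟨u.2, u.2.2, hu₃, c * (1 + u.1.2.2),
    Q * NormedSpace.exp (skewPart d u.1.2.1),
    c • WithLp.toLp 2 (Q.mulVec u.1.1.ofLp) + b, mul_pos hc hu₂,
    mul_mem hQ (exp_mem_specialOrthogonalGroup (by simp [skewPart_apply])), ?_, ?_⟩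
  · have h1 : (c * (1 + u.1.2.2)) • matrixAction n d
        (Q * NormedSpace.exp (skewPart d u.1.2.1)) = (c • act Q).comp
        ((1 + u.1.2.2) • act (NormedSpace.exp (skewPart d u.1.2.1))) := by
      ext1 y
      simp [act, matrixAction_mul, smul_smul, mul_comm]
    rw [h1]
    refine (ContinuousLinearMap.opNorm_comp_le _ _).trans ?_
    rw [norm_smul, Real.norm_of_nonneg hc.le]
    have := mul_le_mul_of_nonneg_left hu₁.le (a := c * ‖act Q‖) (by positivity)
    linarith
  · have h1 : x = (c • matrixAction n d Q) (sliceMap p u) + constConfig n d b := by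
      rw [hux]
      simp [act, smul_smul, hc.ne', ← matrixAction_mul, hQ'.2, matrixAction_one]
    rw [h1, sliceMap]
    simp [matrixAction_mul, smul_smul, matrixAction_constConfig]
    abel

end Similarity

end

end Formation

namespace Formation
noncomputable section
variable {n d : ℕ}

/-! ### The control law as a gradient flow of invariant constraints. -/

section ControlLaw

variable {ι κ : Type}

/-- The constraint functions `(a, k s)` as a map into a Euclidean space. -/
def constraintMap (k : ℝ) (a : Config n d → ι → ℝ) (s : Config n d → κ → ℝ) (p : Config n d) :
    EuclideanSpace ℝ (ι ⊕ κ) :=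
  WithLp.toLp 2 (Sum.elim (a p) fun r => k * s p r)

theorem jacobian_mulVec (F : Config n d → ι → ℝ) (p v : Config n d) (r : ι) :
    (jacobian F p).mulVec v.ofLp r = fderiv ℝ (fun q => F q r) p v := by
  conv_rhs => rw [← (EuclideanSpace.basisFun (Fin n × Fin d) ℝ).sum_repr v]
  simp [jacobian, Matrix.mulVec, dotProduct, mul_comm]

variable {k : ℝ} {a : Config n d → ι → ℝ} {s : Config n d → κ → ℝ}

theorem rigidityMatrix_mulVec_eq_zero (hk : k ≠ 0) {p v : Config n d}
    (h : (weightedRigidityMatrix k a s p).mulVec v.ofLp = 0) :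
    (rigidityMatrix a s p).mulVec v.ofLp = 0 := by
  rw [weightedRigidityMatrix, Matrix.fromRows_mulVec, Matrix.smul_mulVec] at h
  rw [rigidityMatrix, Matrix.fromRows_mulVec]
  ext (r | r)
  · exact congrFun h (Sum.inl r)
  · have := congrFun h (Sum.inr r)
    simpa [hk] using this

variable [Fintype ι] [Fintype κ]

theorem contDiffAt_constraintMap {p : Config n d} {m : WithTop ℕ∞}
    (ha : ∀ r, ContDiffAt ℝ m (fun q => a q r) p) (hs : ∀ r, ContDiffAt ℝ m (fun q => s q r) p) :
    ContDiffAt ℝ m (constraintMap k a s) p := by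
  rw [contDiffAt_euclidean]
  rintro (r | r)
  · exact ha r
  · exact contDiffAt_const.mul (hs r)

theorem fderiv_constraintMap {p : Config n d} (ha : ∀ r, DifferentiableAt ℝ (fun q => a q r) p)
    (hs : ∀ r, DifferentiableAt ℝ (fun q => s q r) p) (v : Config n d) :
    fderiv ℝ (constraintMap k a s) p v =
      WithLp.toLp 2 ((weightedRigidityMatrix k a s p).mulVec v.ofLp) := by
  have hd : DifferentiableAt ℝ (constraintMap k a s) p := by
    rw [differentiableAt_euclidean]
    rintro (r | r)
    · exact ha r
    · exact (hs r).const_mul k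
  have h := fun r => (EuclideanSpace.proj r : EuclideanSpace ℝ (ι ⊕ κ) →L[ℝ] ℝ).hasFDerivAt.comp p
    hd.hasFDerivAt
  ext r
  have h' := congrArg (fun D : Config n d →L[ℝ] ℝ => D v) (h r).fderiv
  rcases r with r | r
  · rw [weightedRigidityMatrix, Matrix.fromRows_mulVec]
    exact h'.symm.trans (jacobian_mulVec a p v r).symm
  · rw [weightedRigidityMatrix, Matrix.fromRows_mulVec, Matrix.smul_mulVec]
    refine h'.symm.trans ?_
    change fderiv ℝ (fun q => k * s q r) p v = k * (jacobian s p).mulVec v.ofLp r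
    rw [jacobian_mulVec, fderiv_const_mul (hs r)]
    rfl

/-- Tested against `v`, both sides are `-⟨e, R̄ v⟩`, by moving the transpose across the inner
product. -/
theorem controlLaw_eq_neg_gradient {pd p : Config n d}
    (ha : ∀ r, DifferentiableAt ℝ (fun q => a q r) p)
    (hs : ∀ r, DifferentiableAt ℝ (fun q => s q r) p)
    (hF : DifferentiableAt ℝ (constraintMap k a s) p) :
    controlLaw k a s pd p =
      -gradient (energy (constraintMap k a s) (constraintMap k a s pd)) p := by
  refine ext_inner_right ℝ fun v => ?_
  rw [inner_neg_left, inner_gradient_energy hF, fderiv_constraintMap ha hs]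
  have he : (constraintMap k a s p - constraintMap k a s pd).ofLp = errorVec k a s pd p := by
    ext (r | r) <;> rfl
  simp only [EuclideanSpace.inner_eq_star_dotProduct, star_trivial, he, controlLaw]
  rw [dotProduct_neg, Matrix.mulVec_transpose, dotProduct_comm v.ofLp, ← Matrix.dotProduct_mulVec,
    dotProduct_comm]

/-- Local exponential convergence for smooth constraint functions that are invariant under
similarities. -/
theorem locallyExpConverges_of_invariant (hk : k ≠ 0) {χ : Set (Config n d)} (hχ : IsOpen χ)
    (ha : ∀ p ∈ χ, ∀ r, ContDiffAt ℝ 2 (fun q => a q r) p)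
    (hs : ∀ p ∈ χ, ∀ r, ContDiffAt ℝ 2 (fun q => s q r) p)
    (hinv : ∀ (c : ℝ) (Q : Matrix (Fin d) (Fin d) ℝ) (b : EuclideanSpace ℝ (Fin d)), 0 < c →
      Q ∈ Matrix.specialOrthogonalGroup (Fin d) ℝ → ∀ p,
        a ((c • matrixAction n d Q) p + constConfig n d b) = a p ∧
        s ((c • matrixAction n d Q) p + constConfig n d b) = s p)
    {pd : Config n d} (hpd : pd ∈ χ) (hψχ : similarityClass pd ⊆ χ) (hrigid : IsIRAS a s pd) :
    LocallyExpConverges χ (controlLaw k a s pd) (similarityClass pd) := by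
  intro q hq
  have hqχ : χ ∈ 𝓝 q := hχ.mem_nhds (hψχ hq)
  set F := constraintMap k a s with hFdef
  have hF : ∀ p ∈ χ, ContDiffAt ℝ 2 F p := fun p hp =>
    contDiffAt_constraintMap (ha p hp) (hs p hp)
  have hFd : ∀ p ∈ χ, DifferentiableAt ℝ F p := fun p hp =>
    (hF p hp).differentiableAt (by simp)
  have had : ∀ p ∈ χ, ∀ r, DifferentiableAt ℝ (fun q => a q r) p := fun p hp r =>
    (ha p hp r).differentiableAt (by simp)
  have hsd : ∀ p ∈ χ, ∀ r, DifferentiableAt ℝ (fun q => s q r) p := fun p hp r =>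
    (hs p hp r).differentiableAt (by simp)
  have hFinv : ∀ (c : ℝ) (Q : Matrix (Fin d) (Fin d) ℝ) (b : EuclideanSpace ℝ (Fin d)), 0 < c →
      Q ∈ Matrix.specialOrthogonalGroup (Fin d) ℝ → ∀ p,
        F ((c • matrixAction n d Q) p + constConfig n d b) = F p := by
    intro c Q b hc hQ p
    simp only [hFdef, constraintMap, (hinv c Q b hc hQ p).1, (hinv c Q b hc hQ p).2]
  -- The only use of rigidity: a kernel vector is trivial, hence orthogonal to itself.
  have hker : ∀ v ∈ (LinearMap.range (trivialMotionMap pd))ᗮ, fderiv ℝ F pd v = 0 → v = 0 := by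
    intro v hv h0
    rw [fderiv_constraintMap (had pd hpd) (hsd pd hpd)] at h0
    have h1 := (hrigid v (rigidityMatrix_mulVec_eq_zero hk (congrArg WithLp.ofLp h0))).mem_range
    exact inner_self_eq_zero.1 ((Submodule.mem_orthogonal _ v).1 hv v h1)
  obtain ⟨C, hC, hslice⟩ := eventually_exists_similarity_slice pd hq
  obtain ⟨c, hc, hPL⟩ := exists_energy_le_norm_gradient_sq (F := F) (x₀ := pd) (x₁ := q)
    (N := (LinearMap.range (trivialMotionMap pd))ᗮ) (ψ := similarityClass pd)
    ((hF pd hpd).of_le (by norm_num)) (Filter.mem_of_superset hqχ hFd) hker hC (fun U hU => by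
      filter_upwards [hslice U hU] with x ⟨s, hs, hsU, c, Q, b, hc, hQ, hcQ, hx⟩
      exact ⟨s, hs, hsU, _, _, hcQ, hx, hFinv c Q b hc hQ,
        mem_similarityClass_iff.2 ⟨c, Q, b, hc, hQ, rfl⟩⟩)
  have hFq : F q = F pd := by
    obtain ⟨c, Q, b, hc, hQ, rfl⟩ := mem_similarityClass_iff.1 hq
    exact hFinv c Q b hc hQ pd
  have hderiv : ∀ᶠ p in 𝓝 q, ‖fderiv ℝ F p‖ < ‖fderiv ℝ F q‖ + 1 := by
    have h : ContinuousAt (fderiv ℝ F) q :=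
      ((hF q (hψχ hq)).fderiv_right (m := 0) (by norm_num)).continuousAt
    exact h.norm.eventually (gt_mem_nhds (lt_add_one _))
  refine gradientFlow_locally_exp_converges (V := energy F (F pd))
    (L := 2 * (‖fderiv ℝ F q‖ + 1) ^ 2) hc (by positivity)
    (contDiffAt_energy (hF q (hψχ hq))) (by simp [energy, hFq]) (energy_nonneg _ _)
    ?_ (hPL.mono fun _ h => h.1) ?_ (hPL.mono fun _ h => h.2) hqχ
  · filter_upwards [hqχ] with p hp
    exact controlLaw_eq_neg_gradient (had p hp) (hsd p hp) (hFd p hp)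
  · filter_upwards [hqχ, hderiv] with p hp hp'
    refine (norm_gradient_energy_le (hFd p hp)).trans ?_
    have := energy_nonneg F (F pd) p
    gcongr

end ControlLaw

/-! ### Smoothness and invariance of the angle and signed constraints. -/

section Constraints

theorem continuous_pos (i : Fin n) : Continuous fun p : Config n d => pos p i := by
  unfold pos; fun_prop

theorem contDiff_pos (i : Fin n) {m : WithTop ℕ∞} :
    ContDiff ℝ m fun p : Config n d => pos p i := by
  rw [contDiff_euclidean]
  intro a
  exact (EuclideanSpace.proj (𝕜 := ℝ) (i, a) : Config n d →L[ℝ] ℝ).contDiff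

theorem contDiffAt_bearing {p : Config n d} {i j : Fin n} (h : pos p j ≠ pos p i)
    {m : WithTop ℕ∞} : ContDiffAt ℝ m (fun q => bearing q i j) p := by
  have h1 : ContDiffAt ℝ m (fun q : Config n d => pos q j - pos q i) p :=
    ((contDiff_pos j).sub (contDiff_pos i)).contDiffAt
  have h2 := sub_ne_zero.2 h
  exact ((h1.norm ℝ h2).inv (norm_ne_zero_iff.2 h2)).smul h1

theorem contDiffAt_bearing_apply {p : Config n d} {i j : Fin n} (h : pos p j ≠ pos p i)
    {m : WithTop ℕ∞} (a : Fin d) : ContDiffAt ℝ m (fun q => bearing q i j a) p :=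
  contDiffAt_euclidean.1 (contDiffAt_bearing h) a

/-- Holds even for coincident agents: the angle is then `π / 2` by convention and a bearing is `0`.
-/
theorem cosAngle_eq_inner (c : Fin n × Fin n × Fin n) (p : Config n d) :
    cosAngle c p = inner ℝ (bearing p c.1 c.2.1) (bearing p c.1 c.2.2) := by
  rw [cosAngle, EuclideanGeometry.angle, InnerProductGeometry.cos_angle, bearing, bearing,
    real_inner_smul_left, real_inner_smul_right, vsub_eq_sub, vsub_eq_sub]
  rw [div_eq_inv_mul, mul_inv, mul_assoc]

theorem inner_mulVec_mulVec {Q : Matrix (Fin d) (Fin d) ℝ}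
    (hQ : Q ∈ Matrix.specialOrthogonalGroup (Fin d) ℝ) (x y : EuclideanSpace ℝ (Fin d)) :
    inner ℝ (WithLp.toLp 2 (Q.mulVec x.ofLp)) (WithLp.toLp 2 (Q.mulVec y.ofLp)) =
      inner ℝ x y := by
  have h := (Matrix.mem_orthogonalGroup_iff' _ _).1 (Matrix.mem_specialOrthogonalGroup_iff.1 hQ).1
  change Q.transpose * Q = 1 at h
  simp only [EuclideanSpace.inner_eq_star_dotProduct, star_trivial]
  rw [Matrix.dotProduct_mulVec, ← Matrix.mulVec_transpose, Matrix.mulVec_mulVec, h,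
    Matrix.one_mulVec]

theorem norm_mulVec {Q : Matrix (Fin d) (Fin d) ℝ}
    (hQ : Q ∈ Matrix.specialOrthogonalGroup (Fin d) ℝ) (x : EuclideanSpace ℝ (Fin d)) :
    ‖WithLp.toLp 2 (Q.mulVec x.ofLp)‖ = ‖x‖ := by
  rw [norm_eq_sqrt_real_inner, inner_mulVec_mulVec hQ, ← norm_eq_sqrt_real_inner]

theorem pos_sub_pos_similarity (c : ℝ) (Q : Matrix (Fin d) (Fin d) ℝ)
    (b : EuclideanSpace ℝ (Fin d)) (p : Config n d) (i j : Fin n) :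
    pos ((c • matrixAction n d Q) p + constConfig n d b) j -
      pos ((c • matrixAction n d Q) p + constConfig n d b) i =
      c • WithLp.toLp 2 (Q.mulVec (pos p j - pos p i).ofLp) := by
  simp [Matrix.mulVec_sub, smul_sub]

/-- Translation cancels in the difference and `c > 0` in the normalization; every constraint
invariance reduces to this. -/
theorem bearing_similarity {c : ℝ} {Q : Matrix (Fin d) (Fin d) ℝ} (b : EuclideanSpace ℝ (Fin d))
    (hc : 0 < c) (hQ : Q ∈ Matrix.specialOrthogonalGroup (Fin d) ℝ) (p : Config n d)
    (i j : Fin n) : bearing ((c • matrixAction n d Q) p + constConfig n d b) i j =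
      WithLp.toLp 2 (Q.mulVec (bearing p i j).ofLp) := by
  rw [bearing, pos_sub_pos_similarity, norm_smul, norm_mulVec hQ, Real.norm_of_nonneg hc.le,
    smul_smul, mul_inv, mul_right_comm, inv_mul_cancel₀ hc.ne', one_mul, bearing, WithLp.ofLp_smul,
    Matrix.mulVec_smul, WithLp.toLp_smul]

theorem pos_ne_pos_of_mem_similarityClass {p q : Config n d} (hq : q ∈ similarityClass p)
    {i j : Fin n} (h : pos p j ≠ pos p i) : pos q j ≠ pos q i := by
  obtain ⟨c, Q, b, hc, hQ, rfl⟩ := mem_similarityClass_iff.1 hq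
  rw [← sub_ne_zero, pos_sub_pos_similarity, ← norm_ne_zero_iff, norm_smul, norm_mulVec hQ]
  exact mul_ne_zero (norm_ne_zero_iff.2 hc.ne') (norm_ne_zero_iff.2 (sub_ne_zero.2 h))

theorem isOpen_setOf_pos_ne (i j : Fin n) : IsOpen {p : Config n d | pos p j ≠ pos p i} :=
  isOpen_ne_fun (continuous_pos j) (continuous_pos i)

theorem cosAngle_similarity {c : ℝ} {Q : Matrix (Fin d) (Fin d) ℝ}
    (b : EuclideanSpace ℝ (Fin d)) (hc : 0 < c)
    (hQ : Q ∈ Matrix.specialOrthogonalGroup (Fin d) ℝ) (p : Config n d)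
    (t : Fin n × Fin n × Fin n) :
    cosAngle t ((c • matrixAction n d Q) p + constConfig n d b) = cosAngle t p := by
  simp only [cosAngle_eq_inner, bearing_similarity b hc hQ, inner_mulVec_mulVec hQ]

theorem signedAngle_similarity {c : ℝ} {Q : Matrix (Fin 2) (Fin 2) ℝ}
    (b : EuclideanSpace ℝ (Fin 2)) (hc : 0 < c)
    (hQ : Q ∈ Matrix.specialOrthogonalGroup (Fin 2) ℝ) (p : Config n 2)
    (t : Fin n × Fin n × Fin n) :
    signedAngle t ((c • matrixAction n 2 Q) p + constConfig n 2 b) = signedAngle t p := by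
  have hdet : Q.det = 1 := (Matrix.mem_specialOrthogonalGroup_iff.1 hQ).2
  rw [Matrix.det_fin_two] at hdet
  simp only [signedAngle, bearing_similarity b hc hQ, Matrix.det_fin_two_of, Matrix.mulVec,
    dotProduct, Fin.sum_univ_two]
  -- Multiplicativity of the determinant; `det Q = 1` is essential, as a reflection would flip the
  -- sign.
  linear_combination (bearing p t.1 t.2.1 0 * bearing p t.1 t.2.2 1 -
    bearing p t.1 t.2.2 0 * bearing p t.1 t.2.1 1) * hdet

theorem signedVolume_similarity {c : ℝ} {Q : Matrix (Fin 3) (Fin 3) ℝ}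
    (b : EuclideanSpace ℝ (Fin 3)) (hc : 0 < c)
    (hQ : Q ∈ Matrix.specialOrthogonalGroup (Fin 3) ℝ) (p : Config n 3)
    (t : Fin n × Fin n × Fin n × Fin n) :
    signedVolume t ((c • matrixAction n 3 Q) p + constConfig n 3 b) = signedVolume t p := by
  have hdet : Q.det = 1 := (Matrix.mem_specialOrthogonalGroup_iff.1 hQ).2
  have h : ∀ u v w : Fin 3 → ℝ, Matrix.det ![Q.mulVec u, Q.mulVec v, Q.mulVec w] =
      Matrix.det ![u, v, w] := by
    intro u v w
    -- The vectors are rows here, so rotating each is right multiplication by `Qᵀ`.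
    have : Matrix.of ![Q.mulVec u, Q.mulVec v, Q.mulVec w] =
        Matrix.of ![u, v, w] * Q.transpose := by
      ext i j
      fin_cases i <;> simp [Matrix.mul_apply, Matrix.mulVec, dotProduct, mul_comm]
    refine (congrArg Matrix.det this).trans ?_
    rw [Matrix.det_mul, Matrix.det_transpose, hdet, mul_one]
    rfl
  simp only [signedVolume, bearing_similarity b hc hQ, triple_product_eq_det, h]

theorem contDiffAt_cosAngle {p : Config n d} {t : Fin n × Fin n × Fin n}
    (h : pos p t.2.1 ≠ pos p t.1 ∧ pos p t.2.2 ≠ pos p t.1) {m : WithTop ℕ∞} :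
    ContDiffAt ℝ m (cosAngle t) p := by
  rw [funext (cosAngle_eq_inner t)]
  exact (contDiffAt_bearing h.1).inner ℝ (contDiffAt_bearing h.2)

theorem contDiffAt_signedAngle {p : Config n 2} {t : Fin n × Fin n × Fin n}
    (h : pos p t.2.1 ≠ pos p t.1 ∧ pos p t.2.2 ≠ pos p t.1) {m : WithTop ℕ∞} :
    ContDiffAt ℝ m (signedAngle t) p := by
  have h₁ := contDiffAt_bearing_apply h.1 (m := m)
  have h₂ := contDiffAt_bearing_apply h.2 (m := m)
  unfold signedAngle
  simp only [Matrix.det_fin_two_of]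
  exact ((h₁ 0).mul (h₂ 1)).sub ((h₂ 0).mul (h₁ 1))

theorem contDiffAt_signedVolume {p : Config n 3} {t : Fin n × Fin n × Fin n × Fin n}
    (h : pos p t.2.1 ≠ pos p t.1 ∧ pos p t.2.2.1 ≠ pos p t.1 ∧ pos p t.2.2.2 ≠ pos p t.1)
    {m : WithTop ℕ∞} : ContDiffAt ℝ m (signedVolume t) p := by
  have h₁ := contDiffAt_bearing_apply h.1 (m := m)
  have h₂ := contDiffAt_bearing_apply h.2.1 (m := m)
  have h₃ := contDiffAt_bearing_apply h.2.2 (m := m)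
  unfold signedVolume
  simp only [cross_apply, dotProduct, Fin.sum_univ_three, Matrix.cons_val]
  exact (((h₁ 0).mul (((h₂ 1).mul (h₃ 2)).sub ((h₂ 2).mul (h₃ 1)))).add
    ((h₁ 1).mul (((h₂ 2).mul (h₃ 0)).sub ((h₂ 0).mul (h₃ 2))))).add
    ((h₁ 2).mul (((h₂ 0).mul (h₃ 1)).sub ((h₂ 1).mul (h₃ 0))))

theorem isOpen_domain2 (A S : Finset (Fin n × Fin n × Fin n)) : IsOpen (domain2 A S) := by
  have h : ∀ T : Finset (Fin n × Fin n × Fin n), IsOpen {p : Config n 2 |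
      ∀ c ∈ T, pos p c.2.1 ≠ pos p c.1 ∧ pos p c.2.2 ≠ pos p c.1} := fun T => by
    simp only [Set.ofPred_forall]
    exact isOpen_biInter_finset fun c _ =>
      (isOpen_setOf_pos_ne c.1 c.2.1).inter (isOpen_setOf_pos_ne c.1 c.2.2)
  exact (h A).inter (h S)

theorem isOpen_domain3 (A : Finset (Fin n × Fin n × Fin n))
    (S : Finset (Fin n × Fin n × Fin n × Fin n)) : IsOpen (domain3 A S) := by
  have hA : IsOpen {p : Config n 3 |
      ∀ c ∈ A, pos p c.2.1 ≠ pos p c.1 ∧ pos p c.2.2 ≠ pos p c.1} := by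
    simp only [Set.ofPred_forall]
    exact isOpen_biInter_finset fun c _ =>
      (isOpen_setOf_pos_ne c.1 c.2.1).inter (isOpen_setOf_pos_ne c.1 c.2.2)
  have hS : IsOpen {p : Config n 3 | ∀ c ∈ S, pos p c.2.1 ≠ pos p c.1 ∧
      pos p c.2.2.1 ≠ pos p c.1 ∧ pos p c.2.2.2 ≠ pos p c.1} := by
    simp only [Set.ofPred_forall]
    exact isOpen_biInter_finset fun c _ => (isOpen_setOf_pos_ne c.1 c.2.1).inter
      ((isOpen_setOf_pos_ne c.1 c.2.2.1).inter (isOpen_setOf_pos_ne c.1 c.2.2.2))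
  exact hA.inter hS

end Constraints

end

end Formation

/-! ### The planar and spatial cases. -/

theorem mainTheorem6 :
    (∀ (n : ℕ) (A S : Finset (Fin n × Fin n × Fin n)) (k : ℝ), k ≠ 0 →
      ∀ pd ∈ Formation.domain2 A S,
        Formation.IsIRAS (Formation.angleFn A) (Formation.signedAngleFn S) pd →
        Formation.LocallyExpConverges (Formation.domain2 A S)
          (Formation.controlLaw k (Formation.angleFn A) (Formation.signedAngleFn S) pd)
          (Formation.similarityClass pd)) ∧
    (∀ (n : ℕ) (A : Finset (Fin n × Fin n × Fin n))
        (S : Finset (Fin n × Fin n × Fin n × Fin n)) (k : ℝ), k ≠ 0 →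
      ∀ pd ∈ Formation.domain3 A S,
        Formation.IsIRAS (Formation.angleFn A) (Formation.signedVolumeFn S) pd →
        Formation.LocallyExpConverges (Formation.domain3 A S)
          (Formation.controlLaw k (Formation.angleFn A) (Formation.signedVolumeFn S) pd)
          (Formation.similarityClass pd)) := by
  open Formation in
  constructor
  · intro n A S k hk pd hpd hrigid
    have hψ : similarityClass pd ⊆ domain2 A S := fun q hq => by
      have h := fun i j => pos_ne_pos_of_mem_similarityClass hq (i := i) (j := j)
      exact ⟨fun c hc => ⟨h _ _ (hpd.1 c hc).1, h _ _ (hpd.1 c hc).2⟩,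
        fun c hc => ⟨h _ _ (hpd.2 c hc).1, h _ _ (hpd.2 c hc).2⟩⟩
    have ha : ∀ p ∈ domain2 A S, ∀ r, ContDiffAt ℝ 2 (fun q => angleFn A q r) p := fun p hp r =>
      contDiffAt_cosAngle (t := r.1) (hp.1 r.1 r.2)
    have hs : ∀ p ∈ domain2 A S, ∀ r, ContDiffAt ℝ 2 (fun q => signedAngleFn S q r) p :=
      fun p hp r => contDiffAt_signedAngle (t := r.1) (hp.2 r.1 r.2)
    exact locallyExpConverges_of_invariant hk (isOpen_domain2 A S) ha hs
      (fun c Q b hc hQ p => ⟨funext fun r => cosAngle_similarity b hc hQ p r.1,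
        funext fun r => signedAngle_similarity b hc hQ p r.1⟩) hpd hψ hrigid
  · intro n A S k hk pd hpd hrigid
    have hψ : similarityClass pd ⊆ domain3 A S := fun q hq => by
      have h := fun i j => pos_ne_pos_of_mem_similarityClass hq (i := i) (j := j)
      exact ⟨fun c hc => ⟨h _ _ (hpd.1 c hc).1, h _ _ (hpd.1 c hc).2⟩,
        fun c hc => ⟨h _ _ (hpd.2 c hc).1, h _ _ (hpd.2 c hc).2.1, h _ _ (hpd.2 c hc).2.2⟩⟩
    have ha : ∀ p ∈ domain3 A S, ∀ r, ContDiffAt ℝ 2 (fun q => angleFn A q r) p := fun p hp r =>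
      contDiffAt_cosAngle (t := r.1) (hp.1 r.1 r.2)
    have hs : ∀ p ∈ domain3 A S, ∀ r, ContDiffAt ℝ 2 (fun q => signedVolumeFn S q r) p :=
      fun p hp r => contDiffAt_signedVolume (t := r.1) (hp.2 r.1 r.2)
    exact locallyExpConverges_of_invariant hk (isOpen_domain3 A S) ha hs
      (fun c Q b hc hQ p => ⟨funext fun r => cosAngle_similarity b hc hQ p r.1,
        funext fun r => signedVolume_similarity b hc hQ p r.1⟩) hpd hψ hrigid
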